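/- Let $A>2\ln 2$. There are constants $c,C>0$, depending only on $A$, such that for every $\varepsilon_0<1$ there is a constant $D>0$, depending only on $A$ and $\varepsilon_0$, with the following property. Let $n\ge 1$, $0<\varepsilon\le\varepsilon_0$, $t=\lceil A/\varepsilon^2\rceil$ and $m=tn$, and assume $t\le 2^{2n}$. Let $K=\mathbb{F}_{2^n}$, identified with $\mathbb{F}_2^n$ by any isomorphism of additive groups. For $\alpha=(\alpha_1,\dots,\alpha_t)\in K^t$ put $$C_\alpha=\{\,w_x=(x,\alpha_1x,\dots,\alpha_tx)\mid x\in K\,\}\subseteq\mathbb{F}_2^{n+m},$$ and let $S_\alpha=(s_p)_p$ be the family of $n+m$ points of $\mathbb{F}_2^n$ (a set with multiplicities), one for each coordinate $p$ of the codewords, where the $j$th bit of $s_p$ is the $p$th bit of $w_{e_j}$ and $e_j$ is the $j$th standard basis vector of $\mathbb{F}_2^n$. Generate $\alpha$ by Nisan's pseudorandom generator with blocks of $b=40n$ bits, as follows. Let $k=\lceil\log_2 t\rceil$. The seed consists of independent uniformly random bits that form a block $z\in\mathbb{F}_2^b$ and, for $l=1,\dots,k$, two strings $a^{(l)}\in\mathbb{F}_2^{2b-1}$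 and $c^{(l)}\in\mathbb{F}_2^b$ that define the hash function $h_l:\mathbb{F}_2^b\to\mathbb{F}_2^b$, $h_l(y)_i=\sum_{j=0}^{b-1}a^{(l)}_{i+j}y_j+c^{(l)}_i$ $(0\le i<b)$. Put $G_0(y)=y$, and let $G_l(y)$ be the concatenation of $G_{l-1}(y)$ and $G_{l-1}(h_l(y))$. Then $\alpha_i$ is given by the first $n$ bits of the $i$th block of $G_k(z)$, for $i=1,\dots,t$. Then: (1) With probability at least $1-C\,2^{-cn}$ over the seed, every nonzero codeword of $C_\alpha$ has Hamming weight at least $(1-\varepsilon)(n+m)/2$, and $S_\alpha$ is $\varepsilon$-biased, that is, for every nonempty $T\subseteq\{1,\dots,n\}$ a uniformly random member $s$ of $S_\alpha$ satisfies $$\Bigl|\Pr\Bigl[\sum_{j\in T}s_j=0\Bigr]-\Pr\Bigl[\sum_{j\in T}s_j=1\Bigr]\Bigr|\le\varepsilon .$$ (2) The number of points of $S_\alpha$, counted with multiplicity, is $n+m\le C\,n/\varepsilon^2$. (3) The seed has at most $D\,n\log_2(1/\varepsilon)$ bits. -/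

import Mathlib

/-- The probability of the event `P` when `ω` is drawn uniformly from the finite nonempty type `Ω`. -/
noncomputable def uniformProb {Ω : Type*} [Fintype Ω] (P : Ω → Prop) : ℝ :=
  (Nat.card {ω : Ω // P ω} : ℝ) / (Fintype.card Ω : ℝ)

section Generator

/-- The convolution hash function `x ↦ a * x + c` on `b`-bit blocks over `𝔽₂`: the matrix of
its linear part has the entry `a (i + j)` at position `(i, j)`.  For uniformly random bits `a`, `c`
this is a pairwise independent family. -/
def convHash {b : ℕ} (a : Fin (2 * b - 1) → ZMod 2) (c : Fin b → ZMod 2)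
    (x : Fin b → ZMod 2) : Fin b → ZMod 2 :=
  fun i => ∑ j : Fin b, a ⟨i.val + j.val, by omega⟩ * x j + c i

/-- Block number `i` (counted from `0`) of Nisan's generator with hash functions `h₀, …, h_{k-1}`:
`G₀(x) = x`, and `G_{k+1}(x; h₀, …, h_k)` is the concatenation of `G_k(x; h₀, …, h_{k-1})` and
`G_k(h_k(x); h₀, …, h_{k-1})`.  The output of `G_k` has the blocks `i = 0, …, 2 ^ k - 1`. -/
def nisanBlock {B : Type*} : (k : ℕ) → (Fin k → B → B) → B → ℕ → B
  | 0, _, x, _ => x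
  | k + 1, h, x, i =>
      if i < 2 ^ k then nisanBlock k (fun j => h j.castSucc) x i
      else nisanBlock k (fun j => h j.castSucc) (h (Fin.last k) x) (i - 2 ^ k)

/-- The positions of the bits of a seed of Nisan's generator with block size `b` and `k` levels:
the `b` bits of the initial block, and for each of the `k` hash functions the `2 * b - 1` bits of `a`
and the `b` bits of `c`. -/
abbrev NisanSeedPos (b k : ℕ) : Type := Fin b ⊕ (Fin k × (Fin (2 * b - 1) ⊕ Fin b))

/-- A seed: one bit for every position. -/
abbrev NisanSeed (b k : ℕ) : Type := NisanSeedPos b k → ZMod 2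

/-- Nisan's generator for `t` blocks of `b` bits: the first `t` of the `2 ^ ⌈log₂ t⌉` blocks. -/
def nisanGenerator (b t : ℕ) (γ : NisanSeed b (Nat.clog 2 t)) : Fin t → Fin b → ZMod 2 :=
  fun i => nisanBlock (Nat.clog 2 t)
    (fun l => convHash (fun r => γ (Sum.inr (l, Sum.inl r))) (fun r => γ (Sum.inr (l, Sum.inr r))))
    (fun r => γ (Sum.inl r)) i.val

end Generator

section Code

variable {n t : ℕ} {K : Type*} [Field K]

/-- The word `w_x = (x, α₁ x, …, α_t x)`, a bit string of `t + 1` blocks of `n` bits.  The field `K`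
is identified with `𝔽₂ⁿ` by the additive isomorphism `e`. -/
def codeword (e : K ≃+ (Fin n → ZMod 2)) (α : Fin t → K) (x : K) :
    Fin (t + 1) × Fin n → ZMod 2 :=
  fun p => e ((Fin.cons x (fun i => α i * x) : Fin (t + 1) → K) p.1) p.2

/-- The code `C_α = {w_x | x}`. -/
def code (e : K ≃+ (Fin n → ZMod 2)) (α : Fin t → K) : Set (Fin (t + 1) × Fin n → ZMod 2) :=
  Set.range (codeword e α)

/-- The points of `𝔽₂ⁿ` given by the code, one for each coordinate `p` of the codewords: column `p`
of the generator matrix whose rows are the codewords of the standard basis vectors of `𝔽₂ⁿ`. -/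
def codePoint (e : K ≃+ (Fin n → ZMod 2)) (α : Fin t → K) (p : Fin (t + 1) × Fin n) :
    Fin n → ZMod 2 :=
  fun j => codeword e α (e.symm (Pi.single j 1)) p

/-- The field elements `α₁, …, α_t` that a seed determines: the generator is run with blocks of
`40 n` bits, and all but the first `n` bits of each block are ignored. -/
def nisanAlpha (e : K ≃+ (Fin n → ZMod 2)) (t : ℕ)
    (γ : NisanSeed (40 * n) (Nat.clog 2 t)) : Fin t → K :=
  fun i => e.symm (fun j => nisanGenerator (40 * n) t γ i ⟨j.val, by omega⟩)

end Code

/-- A finite family `S` of points of `𝔽₂ⁿ` (a set with multiplicities) is `ε`-biased if, for every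
nonempty set `T` of coordinates, the parity of the bits in `T` of a uniformly random member
satisfies `|Pr[parity = 0] - Pr[parity = 1]| ≤ ε`. -/
def IsEpsBiased {n : ℕ} {ι : Type*} [Fintype ι] (S : ι → Fin n → ZMod 2) (ε : ℝ) : Prop :=
  ∀ T : Finset (Fin n), T.Nonempty →
    |uniformProb (fun i : ι => ∑ j ∈ T, S i j = 0) -
      uniformProb (fun i : ι => ∑ j ∈ T, S i j = 1)| ≤ ε

/-! For fixed nonzero `x`, the weight of `w_x` is the weight of `x` plus a sum of functions of the
single `α i`. Modulo `N + 1`, where `N = (t + 1) * n` is the length, this sum determines the weight,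
and a character of it is a product of tests of single blocks. Nisan's generator nearly preserves the
mean of such a product (`expect_norm_nisan_sub_le`): each doubling step costs one application of a
mixing lemma for pairwise independent hashing (`expect_norm_hash_sub_le`). Fourier inversion turns
this into closeness of all events (`abs_uniformProb_nisanAlpha_sub_le`), so the generated `α` may be
replaced by a uniform one.

For uniform `α`, summing the failure probability over all `x` makes the first block uniform too. The
sum is therefore `2 ^ n` times the probability that a uniform word of length `N` is unbalanced, and
Chernoff bounds it by `2 ^ n * 2 * exp (-ε² N / 2)`. As `ε² t ≥ A > 2 log 2`, this is exponentially
small. The generator error, with blocks of `40 n` bits, is smaller still. Bias and distance are the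
same condition, because the parities of the points over `T` are the coordinates of one nonzero
codeword. -/

open Finset
open scoped BigOperators

/-! ### Convolution hashing is pairwise independent -/

/-- A surjective homomorphism of finite groups pushes the uniform distribution forward to the
uniform distribution. -/
theorem expect_comp_of_surjective {G H M : Type*} [AddGroup G] [AddCommGroup H] [Fintype G]
    [Fintype H] [AddCommMonoid M] [Module ℚ≥0 M] (f : G →+ H) (hf : Function.Surjective f)
    (ψ : H → M) : 𝔼 g, ψ (f g) = 𝔼 h, ψ h := by
  -- Translating by any `h` in the image leaves the mean unchanged, so one may average over `h` as
  -- well.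
  have key : ∀ h : H, 𝔼 g, ψ (f g + h) = 𝔼 g, ψ (f g) := by
    intro h
    obtain ⟨g₀, rfl⟩ := hf h
    exact Fintype.expect_equiv (Equiv.addRight g₀) _ _ (fun g => by simp)
  calc 𝔼 g, ψ (f g) = 𝔼 h : H, 𝔼 g, ψ (f g + h) := by
        rw [expect_congr rfl (fun h _ => key h), Fintype.expect_const]
    _ = 𝔼 g, 𝔼 h, ψ (f g + h) := expect_comm _ _ _
    _ = 𝔼 _g : G, 𝔼 h, ψ h :=
        expect_congr rfl (fun g _ =>
          Fintype.expect_equiv (Equiv.addLeft (f g)) _ _ (fun h => by simp))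
    _ = 𝔼 h, ψ h := Fintype.expect_const _

/-- A finite family of functions `B → B` is pairwise independent if the values of a random member
at two distinct points are independent and uniformly distributed. -/
def PairwiseIndepFamily {H B : Type*} [Fintype H] [Fintype B] (act : H → B → B) : Prop :=
  ∀ y y' : B, y ≠ y' → ∀ φ ψ : B → ℂ,
    𝔼 h, φ (act h y) * ψ (act h y') = (𝔼 y, φ y) * 𝔼 y, ψ y

/-- Convolution with a fixed string `d`, as a function of the coefficient string. -/
def hankelHom {b : ℕ} (d : Fin b → ZMod 2) :
    (Fin (2 * b - 1) → ZMod 2) →+ (Fin b → ZMod 2) where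
  toFun a := fun i => ∑ j : Fin b, a ⟨i.val + j.val, by omega⟩ * d j
  map_zero' := by ext; simp
  map_add' a a' := by ext; simp [add_mul, sum_add_distrib]

theorem hankelHom_apply {b : ℕ} (d : Fin b → ZMod 2) (a : Fin (2 * b - 1) → ZMod 2) (i : Fin b) :
    hankelHom d a i = ∑ j : Fin b, a ⟨i.val + j.val, by omega⟩ * d j := rfl

/-- The system is triangular. If `j₀` is the last index with `d j₀ ≠ 0`, the coefficient at `s + j₀`
enters row `s` with factor `d j₀` and no earlier row, so the rows can be solved in order. -/
theorem hankelHom_surjective {b : ℕ} {d : Fin b → ZMod 2} (hd : d ≠ 0) :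
    Function.Surjective (hankelHom d) := by
  classical
  have hne : (univ.filter (fun j => d j ≠ 0)).Nonempty := by
    obtain ⟨j, hj⟩ := Function.ne_iff.mp hd
    exact ⟨j, by simpa using hj⟩
  obtain ⟨j₀, hj₀, hmax⟩ := exists_max_image (univ.filter (fun j => d j ≠ 0)) id hne
  have hj₀ : d j₀ ≠ 0 := (mem_filter.mp hj₀).2
  have hzero : ∀ j, j₀ < j → d j = 0 := by
    intro j hj
    by_contra h
    exact absurd (hmax j (by simpa using h)) (not_le.mpr hj)
  intro v
  have key : ∀ s : ℕ, s ≤ b → ∃ a, ∀ i : Fin b, i.val < s → hankelHom d a i = v i := by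
    intro s
    induction s with
    | zero => exact fun _ => ⟨0, fun i hi => absurd hi (Nat.not_lt_zero _)⟩
    | succ s ih =>
      intro hs
      obtain ⟨a, ha⟩ := ih (by omega)
      let r : Fin (2 * b - 1) := ⟨s + j₀.val, by omega⟩
      let u : ZMod 2 := (v ⟨s, hs⟩ - hankelHom d a ⟨s, hs⟩) / d j₀
      refine ⟨a + Pi.single r u, fun i hi => ?_⟩
      rw [map_add, Pi.add_apply]
      rcases Nat.lt_succ_iff_lt_or_eq.mp hi with hi' | hi'
      · rw [ha i hi']
        suffices h : hankelHom d (Pi.single r u) i = 0 by rw [h, add_zero]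
        rw [hankelHom_apply]
        refine sum_eq_zero (fun j _ => ?_)
        by_cases hj : i.val + j.val = s + j₀.val
        · rw [hzero j (by rw [Fin.lt_def]; omega), mul_zero]
        · rw [Pi.single_eq_of_ne (by simpa [r, Fin.ext_iff] using hj), zero_mul]
      · obtain rfl : i = ⟨s, hs⟩ := Fin.ext hi'
        have h : hankelHom d (Pi.single r u) ⟨s, hs⟩ = u * d j₀ := by
          rw [hankelHom_apply]
          refine (sum_eq_single j₀ (fun j _ hj => ?_) (fun h => absurd (mem_univ _) h)).trans ?_
          · have : s + j.val ≠ s + j₀.val := fun h => hj (Fin.ext (by omega))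
            rw [Pi.single_eq_of_ne (by simpa [r, Fin.ext_iff] using this), zero_mul]
          · rw [Pi.single_eq_same]
        rw [h, div_mul_cancel₀ _ hj₀]
        abel
  obtain ⟨a, ha⟩ := key b le_rfl
  exact ⟨a, funext fun i => ha i i.isLt⟩

theorem convHash_eq {b : ℕ} (a : Fin (2 * b - 1) → ZMod 2) (c x : Fin b → ZMod 2) :
    convHash a c x = hankelHom x a + c := rfl

theorem convHash_eq_add {b : ℕ} (a : Fin (2 * b - 1) → ZMod 2) (c x x' : Fin b → ZMod 2) :
    convHash a c x' = convHash a c x + hankelHom (x' - x) a := by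
  ext i
  simp only [convHash_eq, Pi.add_apply, hankelHom, AddMonoidHom.coe_mk, ZeroHom.coe_mk,
    Pi.sub_apply, mul_sub, sum_sub_distrib]
  abel

/-- The shift `c` makes the value at `y` uniform for each `a`. The difference of the two values is
`hankelHom (y' - y) a`, which does not involve `c` and is uniform by surjectivity. -/
theorem pairwiseIndepFamily_convHash (b : ℕ) :
    PairwiseIndepFamily
      (fun h : (Fin (2 * b - 1) → ZMod 2) × (Fin b → ZMod 2) => convHash h.1 h.2) := by
  intro y y' hy φ ψ
  have hd : y' - y ≠ 0 := sub_ne_zero.mpr hy.symm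
  rw [← univ_product_univ, expect_product]
  calc 𝔼 a, 𝔼 c, φ (convHash a c y) * ψ (convHash a c y')
      = 𝔼 a, 𝔼 c, φ c * ψ (c + hankelHom (y' - y) a) :=
        expect_congr rfl (fun a _ => Fintype.expect_equiv (Equiv.addLeft (hankelHom y a)) _ _
          (fun c => by rw [convHash_eq_add a c y y', convHash_eq]; rfl))
    _ = 𝔼 c, 𝔼 a, φ c * ψ (c + hankelHom (y' - y) a) := expect_comm _ _ _
    _ = 𝔼 c, φ c * 𝔼 v, ψ v := expect_congr rfl (fun c _ => by
          rw [← mul_expect, expect_comp_of_surjective (hankelHom (y' - y))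
            (hankelHom_surjective hd) (fun v => ψ (c + v))]
          congr 1
          exact Fintype.expect_equiv (Equiv.addLeft c) _ _ (fun _ => rfl))
    _ = _ := (expect_mul _ _ _).symm

/-! ### Nisan's generator against product tests -/

theorem norm_complex_expect_le {ι : Type*} (s : Finset ι) (f : ι → ℂ) :
    ‖𝔼 i ∈ s, f i‖ ≤ 𝔼 i ∈ s, ‖f i‖ :=
  RCLike.norm_expect_le (K := ℂ)

theorem conj_expect {ι : Type*} (s : Finset ι) (f : ι → ℂ) :
    starRingEnd ℂ (𝔼 i ∈ s, f i) = 𝔼 i ∈ s, starRingEnd ℂ (f i) := by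
  simp only [expect_eq_sum_div_card, map_div₀, map_sum, map_natCast]

section Product

variable {H B : Type*} [Fintype H] [Fintype B] [Nonempty H] [Nonempty B]

theorem norm_expect_le_one {f : B → ℂ} (hf : ∀ y, ‖f y‖ ≤ 1) : ‖𝔼 y, f y‖ ≤ 1 :=
  (norm_complex_expect_le _ f).trans (expect_le univ_nonempty (fun y _ => hf y))

/-- A second moment argument: after centring `G`, pairwise independence kills every off-diagonal
term of the squared deviation. The diagonal contributes at most `4 / |B|`, and Cauchy–Schwarz passes
to the first moment. -/
theorem expect_norm_hash_sub_le {act : H → B → B} (hact : PairwiseIndepFamily act) {F G : B → ℂ}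
    (hF : ∀ y, ‖F y‖ ≤ 1) (hG : ∀ y, ‖G y‖ ≤ 1) :
    𝔼 h, ‖𝔼 y, F y * G (act h y) - (𝔼 y, F y) * 𝔼 y, G y‖ ≤ 2 / √(Fintype.card B) := by
  classical
  set g : B → ℂ := fun y => G y - 𝔼 y, G y with hgdef
  have hg0 : 𝔼 y, g y = 0 := by
    simp only [hgdef]
    rw [expect_sub_distrib, Fintype.expect_const, sub_self]
  have hg2 : ∀ y, ‖g y‖ ≤ 2 := fun y =>
    (norm_sub_le _ _).trans (by linarith [hG y, norm_expect_le_one hG])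
  set X : H → ℂ := fun h => 𝔼 y, F y * g (act h y) with hX
  have hXeq : ∀ h, 𝔼 y, F y * G (act h y) - (𝔼 y, F y) * 𝔼 y, G y = X h := by
    intro h
    simp only [hX, hgdef, mul_sub]
    rw [expect_sub_distrib, expect_mul]
  simp only [hXeq]
  have hsq : ((𝔼 h, ‖X h‖ ^ 2 : ℝ) : ℂ) =
      𝔼 y, 𝔼 y', F y * starRingEnd ℂ (F y') *
        𝔼 h, g (act h y) * starRingEnd ℂ (g (act h y')) := by
    rw [Complex.ofReal_expect]
    calc 𝔼 h, ((‖X h‖ ^ 2 : ℝ) : ℂ)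
        = 𝔼 h, 𝔼 y, 𝔼 y', F y * starRingEnd ℂ (F y') *
            (g (act h y) * starRingEnd ℂ (g (act h y'))) := by
          refine expect_congr rfl (fun h _ => ?_)
          rw [Complex.ofReal_pow, ← Complex.mul_conj']
          simp only [hX]
          rw [conj_expect, expect_mul_expect]
          refine expect_congr rfl (fun y _ => expect_congr rfl (fun y' _ => ?_))
          rw [map_mul]
          ring
      _ = _ := by
          rw [expect_comm]
          refine expect_congr rfl (fun y _ => ?_)
          rw [expect_comm]
          exact expect_congr rfl (fun y' _ => (mul_expect _ _ _).symm)
  have hbound : 𝔼 h, ‖X h‖ ^ 2 ≤ 4 / Fintype.card B := by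
    have h0 : 0 ≤ 𝔼 h, ‖X h‖ ^ 2 := expect_nonneg (fun h _ => by positivity)
    have : 𝔼 h, ‖X h‖ ^ 2 = ‖((𝔼 h, ‖X h‖ ^ 2 : ℝ) : ℂ)‖ := by
      rw [Complex.norm_real, Real.norm_of_nonneg h0]
    rw [this, hsq]
    have hterm : ∀ y y', ‖F y * starRingEnd ℂ (F y') *
        𝔼 h, g (act h y) * starRingEnd ℂ (g (act h y'))‖ ≤ if y = y' then (4 : ℝ) else 0 := by
      intro y y'
      split_ifs with hyy
      · rw [norm_mul, norm_mul, RCLike.norm_conj]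
        have h1 : ‖𝔼 h, g (act h y) * starRingEnd ℂ (g (act h y'))‖ ≤ 4 := by
          refine (norm_complex_expect_le _ _).trans (expect_le univ_nonempty (fun h _ => ?_))
          rw [norm_mul, RCLike.norm_conj]
          nlinarith [hg2 (act h y), hg2 (act h y'), norm_nonneg (g (act h y)),
            norm_nonneg (g (act h y'))]
        have h2 : ‖F y‖ * ‖F y'‖ ≤ 1 :=
          mul_le_one₀ (hF y) (norm_nonneg _) (hF y')
        calc _ ≤ 1 * 4 := mul_le_mul h2 h1 (norm_nonneg _) zero_le_one
          _ = 4 := one_mul _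
      · rw [hact y y' hyy g (fun z => starRingEnd ℂ (g z)), hg0]
        simp
    calc _ ≤ 𝔼 y, 𝔼 y', (if y = y' then (4 : ℝ) else 0) :=
          (norm_complex_expect_le _ _).trans (expect_le_expect (fun y _ =>
            (norm_complex_expect_le _ _).trans (expect_le_expect (fun y' _ => hterm y y'))))
      _ = 4 / Fintype.card B := by
          simp only [Fintype.expect_ite_eq]
          rw [Fintype.expect_const, NNRat.smul_def]
          push_cast
          rw [div_eq_inv_mul]
  have hcs : (𝔼 h, ‖X h‖) ^ 2 ≤ 𝔼 h, ‖X h‖ ^ 2 := by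
    have := expect_mul_sq_le_sq_mul_sq univ (fun h => ‖X h‖) (fun _ : H => (1 : ℝ))
    simpa using this
  have hB : (0 : ℝ) < Fintype.card B := by exact_mod_cast Fintype.card_pos
  refine (sq_le_sq₀ (expect_nonneg (fun h _ => norm_nonneg _)) (by positivity)).mp ?_
  rw [div_pow, Real.sq_sqrt hB.le]
  linarith

/-- Once the lower hash functions are fixed, the two halves of the output are fixed functions of `y`
and of `h y`, so the mixing lemma decouples them at cost `η`. Both halves reuse the same lower hash
functions, which is why the error is averaged over them outside the norm. The recursion `η + 2 * (2
^ k - 1) * η` gives the factor `2 ^ k - 1`. -/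
theorem expect_norm_nisan_sub_le {act : H → B → B} (hact : PairwiseIndepFamily act) (k : ℕ)
    (f : ℕ → B → ℂ) (hf : ∀ i y, ‖f i y‖ ≤ 1) :
    𝔼 hs : Fin k → H, ‖𝔼 y, ∏ i ∈ range (2 ^ k), f i (nisanBlock k (fun l => act (hs l)) y i) -
        ∏ i ∈ range (2 ^ k), 𝔼 y, f i y‖ ≤ (2 ^ k - 1) * (2 / √(Fintype.card B)) := by
  induction k generalizing f with
  | zero => simp [nisanBlock]
  | succ k ih =>
    set η : ℝ := 2 / √(Fintype.card B)
    let F : (ℕ → B → ℂ) → (Fin k → H) → B → ℂ := fun f hs y =>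
      ∏ i ∈ range (2 ^ k), f i (nisanBlock k (fun l => act (hs l)) y i)
    let f' : ℕ → B → ℂ := fun i => f (2 ^ k + i)
    have hprod : ∀ u : ℕ → ℂ, ∏ i ∈ range (2 ^ (k + 1)), u i =
        (∏ i ∈ range (2 ^ k), u i) * ∏ i ∈ range (2 ^ k), u (2 ^ k + i) := by
      intro u
      rw [pow_succ, mul_two, prod_range_add]
    have hF : ∀ hs y, ‖F f hs y‖ ≤ 1 := fun hs y => by
      rw [norm_prod]
      exact prod_le_one (fun _ _ => norm_nonneg _) (fun _ _ => hf _ _)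
    have hF' : ∀ hs y, ‖F f' hs y‖ ≤ 1 := fun hs y => by
      rw [norm_prod]
      exact prod_le_one (fun _ _ => norm_nonneg _) (fun _ _ => hf _ _)
    have hsplit : ∀ (h : H) (hs : Fin k → H) (y : B),
        ∏ i ∈ range (2 ^ (k + 1)), f i (nisanBlock (k + 1)
          (fun l => act (Fin.snoc (α := fun _ => H) hs h l)) y i) =
        F f hs y * F f' hs (act h y) := by
      intro h hs y
      rw [hprod]
      congr 1
      · refine prod_congr rfl (fun i hi => ?_)
        simp [nisanBlock, mem_range.mp hi]
      · refine prod_congr rfl (fun i hi => ?_)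
        simp [nisanBlock, f']
    have hν : ‖∏ i ∈ range (2 ^ k), 𝔼 y, f i y‖ ≤ 1 := by
      rw [norm_prod]
      exact prod_le_one (fun _ _ => norm_nonneg _) (fun _ _ => norm_expect_le_one (hf _))
    have h1 := ih f hf
    have h2 := ih f' (fun i y => hf _ y)
    calc _ = 𝔼 hs : Fin k → H, 𝔼 h, ‖𝔼 y, F f hs y * F f' hs (act h y) -
          (∏ i ∈ range (2 ^ k), 𝔼 y, f i y) * ∏ i ∈ range (2 ^ k), 𝔼 y, f' i y‖ := by
          rw [expect_comm, ← expect_product', univ_product_univ]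
          refine (Fintype.expect_equiv (Fin.snocEquiv (fun _ : Fin (k + 1) => H)) _ _ ?_).symm
          rintro ⟨h, hs⟩
          rw [hprod]
          simp only [← hsplit]
          rfl
      _ ≤ 𝔼 hs : Fin k → H, (η + (‖𝔼 y, F f hs y - ∏ i ∈ range (2 ^ k), 𝔼 y, f i y‖ +
            ‖𝔼 y, F f' hs y - ∏ i ∈ range (2 ^ k), 𝔼 y, f' i y‖)) := by
          refine expect_le_expect (fun hs _ => ?_)
          set μ := 𝔼 y, F f hs y
          set μ' := 𝔼 y, F f' hs y
          set ν := ∏ i ∈ range (2 ^ k), 𝔼 y, f i y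
          set ν' := ∏ i ∈ range (2 ^ k), 𝔼 y, f' i y
          have hμ' : ‖μ'‖ ≤ 1 := norm_expect_le_one (hF' hs)
          have hd : ‖μ * μ' - ν * ν'‖ ≤ ‖μ - ν‖ + ‖μ' - ν'‖ := by
            have : μ * μ' - ν * ν' = (μ - ν) * μ' + ν * (μ' - ν') := by ring
            rw [this]
            refine (norm_add_le _ _).trans ?_
            rw [norm_mul, norm_mul]
            exact add_le_add (mul_le_of_le_one_right (norm_nonneg _) hμ')
              (mul_le_of_le_one_left (norm_nonneg _) hν)
          calc _ ≤ 𝔼 h, (‖𝔼 y, F f hs y * F f' hs (act h y) - μ * μ'‖ +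
                (‖μ - ν‖ + ‖μ' - ν'‖)) :=
                expect_le_expect (fun h _ => (norm_sub_le_norm_sub_add_norm_sub _ (μ * μ') _).trans
                  (by gcongr))
            _ ≤ _ := by
                rw [expect_add_distrib, Fintype.expect_const]
                gcongr
                exact expect_norm_hash_sub_le hact (hF hs) (hF' hs)
      _ ≤ η + ((2 ^ k - 1) * η + (2 ^ k - 1) * η) := by
          rw [expect_add_distrib, expect_add_distrib, Fintype.expect_const]
          gcongr
      _ = _ := by rw [pow_succ]; ring

end Product

/-! ### Probabilities, characters and Fourier inversion -/

theorem uniformProb_eq_expect {Ω : Type*} [Fintype Ω] (P : Ω → Prop) [DecidablePred P] :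
    uniformProb P = 𝔼 ω, if P ω then (1 : ℝ) else 0 := by
  rw [uniformProb, Fintype.expect_eq_sum_div_card, sum_boole, Nat.card_eq_fintype_card,
    Fintype.card_subtype]

theorem uniformProb_mono {Ω : Type*} [Fintype Ω] {P Q : Ω → Prop} (h : ∀ ω, P ω → Q ω) :
    uniformProb P ≤ uniformProb Q := by
  classical
  rw [uniformProb_eq_expect, uniformProb_eq_expect]
  refine expect_le_expect (fun ω _ => ?_)
  by_cases hP : P ω
  · simp [hP, h ω hP]
  · simp only [hP, if_false]
    split_ifs <;> norm_num

theorem uniformProb_equiv {Ω Ω' : Type*} [Fintype Ω] [Fintype Ω'] (f : Ω ≃ Ω') (P : Ω' → Prop) :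
    uniformProb (fun ω => P (f ω)) = uniformProb P := by
  classical
  rw [uniformProb_eq_expect, uniformProb_eq_expect]
  exact Fintype.expect_equiv f _ _ (fun _ => rfl)

theorem expect_pi_prod {ι κ R : Type*} [Fintype ι] [Fintype κ] [DecidableEq ι] [Field R]
    [CharZero R] (f : ι → κ → R) :
    𝔼 x : ι → κ, ∏ i, f i (x i) = ∏ i, 𝔼 y, f i y := by
  simp only [Fintype.expect_eq_sum_div_card, prod_div_distrib, prod_univ_sum,
    Fintype.piFinset_univ, prod_const, card_univ, Fintype.card_fun, Nat.cast_pow]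

theorem addChar_sum {ι G R : Type*} [AddCommMonoid G] [CommMonoid R] (ψ : AddChar G R)
    (s : Finset ι) (u : ι → G) : ψ (∑ i ∈ s, u i) = ∏ i ∈ s, ψ (u i) := by
  classical
  induction s using Finset.induction_on with
  | empty => simp
  | insert i s hi ih => rw [sum_insert hi, prod_insert hi, AddChar.map_add_eq_mul, ih]

theorem uniformProb_eq_sum_addChar {Ω G : Type*} [Fintype Ω] [AddCommGroup G] [Fintype G]
    (w : Ω → G) (P : G → Prop) [DecidablePred P] :
    ((uniformProb (fun ω => P (w ω)) : ℝ) : ℂ) =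
      ∑ s with P s, 𝔼 ψ : AddChar G ℂ, ψ (-s) * 𝔼 ω, ψ (w ω) := by
  classical
  have hind : ∀ g : G, (if P g then (1 : ℂ) else 0) =
      ∑ s with P s, 𝔼 ψ : AddChar G ℂ, ψ (-s) * ψ g := by
    intro g
    have h : ∀ s, 𝔼 ψ : AddChar G ℂ, ψ (-s) * ψ g = if s = g then 1 else 0 := by
      intro s
      have := AddChar.expect_apply_eq_ite (-s + g)
      simp only [AddChar.map_add_eq_mul] at this
      rw [this]
      simp [neg_add_eq_zero]
    simp [h]
  rw [uniformProb_eq_expect, Complex.ofReal_expect]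
  calc _ = 𝔼 ω, ∑ s with P s, 𝔼 ψ : AddChar G ℂ, ψ (-s) * ψ (w ω) :=
        expect_congr rfl (fun ω _ => by rw [← hind]; split_ifs <;> simp)
    _ = _ := by
        rw [expect_sum_comm]
        refine sum_congr rfl (fun s _ => ?_)
        rw [expect_comm]
        exact expect_congr rfl (fun ψ _ => (mul_expect _ _ _).symm)

/-- If all characters of a finite abelian group `G` have nearly the same mean under two random
variables with values in `G`, then every event has nearly the same probability. -/
theorem abs_uniformProb_sub_le_of_addChar {Ω Ω' G : Type*} [Fintype Ω] [Fintype Ω']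
    [AddCommGroup G] [Fintype G] (u : Ω → G) (v : Ω' → G) {δ : ℝ}
    (h : ∀ ψ : AddChar G ℂ, ‖𝔼 ω, ψ (u ω) - 𝔼 ω, ψ (v ω)‖ ≤ δ) (P : G → Prop) :
    |uniformProb (fun ω => P (u ω)) - uniformProb (fun ω => P (v ω))| ≤ Fintype.card G * δ := by
  classical
  have hδ : 0 ≤ δ := (norm_nonneg _).trans (h 0)
  rw [← Real.norm_eq_abs, ← Complex.norm_real, Complex.ofReal_sub, uniformProb_eq_sum_addChar,
    uniformProb_eq_sum_addChar, ← sum_sub_distrib]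
  -- By inversion, each single point has probability changed by at most `δ`; an event has at most
  -- `|G|` points.
  calc _ ≤ ∑ s with P s, δ := by
        refine norm_sum_le_of_le _ (fun s _ => ?_)
        rw [← expect_sub_distrib]
        refine (norm_complex_expect_le _ _).trans (expect_le univ_nonempty (fun ψ _ => ?_))
        rw [← mul_sub, norm_mul, AddChar.norm_apply, one_mul]
        exact h ψ
    _ ≤ Fintype.card G * δ := by
        rw [sum_const, nsmul_eq_mul]
        gcongr
        exact card_le_univ _

/-- A seed consists of the coefficients of the hash functions and of the initial block. -/
def nisanSeedEquiv (b k : ℕ) : NisanSeed b k ≃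
    (Fin k → (Fin (2 * b - 1) → ZMod 2) × (Fin b → ZMod 2)) × (Fin b → ZMod 2) where
  toFun γ := (fun l => (fun r => γ (Sum.inr (l, Sum.inl r)), fun r => γ (Sum.inr (l, Sum.inr r))),
    fun r => γ (Sum.inl r))
  invFun s := Sum.elim s.2 (fun p => Sum.elim (s.1 p.1).1 (s.1 p.1).2 p.2)
  left_inv γ := by
    ext p
    rcases p with p | ⟨l, p | p⟩ <;> rfl
  right_inv _ := rfl

theorem norm_expect_nisanGenerator_sub_le (b t : ℕ) (f : Fin t → (Fin b → ZMod 2) → ℂ)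
    (hf : ∀ i y, ‖f i y‖ ≤ 1) :
    ‖𝔼 γ : NisanSeed b (Nat.clog 2 t), ∏ i, f i (nisanGenerator b t γ i) - ∏ i, 𝔼 y, f i y‖ ≤
      2 ^ Nat.clog 2 t * (2 / √(2 ^ b)) := by
  set k := Nat.clog 2 t with hk
  have htk : t ≤ 2 ^ k := Nat.le_pow_clog one_lt_two t
  -- The unused blocks from `t` to `2 ^ k - 1` get the trivial test `1`.
  let f' : ℕ → (Fin b → ZMod 2) → ℂ := fun i y => if h : i < t then f ⟨i, h⟩ y else 1
  have hf' : ∀ i y, ‖f' i y‖ ≤ 1 := by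
    intro i y
    by_cases h : i < t
    · simpa [f', h] using hf ⟨i, h⟩ y
    · simp [f', h]
  have hprod : ∀ u : ℕ → ℂ, (∀ i, t ≤ i → u i = 1) →
      ∏ i ∈ range (2 ^ k), u i = ∏ i : Fin t, u i := by
    intro u hu
    rw [← prod_range]
    exact (prod_subset (range_subset_range.mpr htk) (fun i _ hi => hu i (by simpa using hi))).symm
  have hf1 : ∀ i, t ≤ i → ∀ y, f' i y = 1 := fun i hi y => by simp [f', not_lt.mpr hi]
  have key := expect_norm_nisan_sub_le (pairwiseIndepFamily_convHash b) k f' hf'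
  have hcard : (Fintype.card (Fin b → ZMod 2) : ℝ) = 2 ^ b := by
    simp [ZMod.card]
  have hmain : 𝔼 γ : NisanSeed b k, ∏ i, f i (nisanGenerator b t γ i) =
      𝔼 hs : Fin k → (Fin (2 * b - 1) → ZMod 2) × (Fin b → ZMod 2), 𝔼 y,
        ∏ i ∈ range (2 ^ k),
          f' i (nisanBlock k (fun l => convHash (hs l).1 (hs l).2) y i) := by
    rw [← expect_product', univ_product_univ]
    refine Fintype.expect_equiv (nisanSeedEquiv b k) _ _ (fun γ => ?_)
    rw [hprod _ (fun i hi => hf1 i hi _)]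
    refine prod_congr rfl (fun i _ => ?_)
    simp only [f', i.isLt, dif_pos]
    rfl
  have hν : ∏ i, 𝔼 y, f i y = ∏ i ∈ range (2 ^ k), 𝔼 y, f' i y := by
    rw [hprod _ (fun i hi => by simp only [hf1 i hi]; exact Fintype.expect_const _)]
    exact prod_congr rfl (fun i _ => by simp [f'])
  rw [hmain, hν]
  refine le_trans ?_ (key.trans ?_)
  · rw [← Fintype.expect_const
      (ι := Fin k → (Fin (2 * b - 1) → ZMod 2) × (Fin b → ZMod 2))
      (∏ i ∈ range (2 ^ k), 𝔼 y, f' i y), ← expect_sub_distrib]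
    refine (norm_complex_expect_le _ _).trans (le_of_eq ?_)
    rw [Fintype.expect_const]
  · rw [hcard]
    gcongr
    linarith

/-! ### From bit blocks to field elements -/

section Alpha

variable {n t : ℕ} {K : Type*} [Field K]

/-- The element of `K` given by the first `n` bits of a block of `40 * n` bits. -/
def blockHom (e : K ≃+ (Fin n → ZMod 2)) : (Fin (40 * n) → ZMod 2) →+ K :=
  e.symm.toAddMonoidHom.comp
    { toFun := fun y j => y ⟨j.val, by omega⟩
      map_zero' := rfl
      map_add' := fun _ _ => rfl }

theorem blockHom_surjective (e : K ≃+ (Fin n → ZMod 2)) : Function.Surjective (blockHom e) := by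
  intro a
  refine ⟨fun r => if h : r.val < n then e a ⟨r.val, h⟩ else 0, ?_⟩
  simp [blockHom]

theorem abs_uniformProb_nisanAlpha_sub_le [Fintype K] (e : K ≃+ (Fin n → ZMod 2)) {G : Type*}
    [AddCommGroup G] [Fintype G] (u : K → G) (P : G → Prop) :
    |uniformProb (fun γ => P (∑ i, u (nisanAlpha e t γ i))) -
      uniformProb (fun α : Fin t → K => P (∑ i, u (α i)))| ≤
      Fintype.card G * (2 ^ Nat.clog 2 t * (2 / √(2 ^ (40 * n)))) := by
  refine abs_uniformProb_sub_le_of_addChar (fun γ => ∑ i, u (nisanAlpha e t γ i))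
    (fun α : Fin t → K => ∑ i, u (α i)) (fun ψ => ?_) P
  have h := norm_expect_nisanGenerator_sub_le (40 * n) t (fun _ y => ψ (u (blockHom e y)))
    (fun i y => (AddChar.norm_apply ψ _).le)
  convert h using 3
  · refine expect_congr rfl (fun γ _ => ?_)
    rw [addChar_sum]
    rfl
  · simp only [addChar_sum]
    rw [expect_pi_prod (fun _ a => ψ (u a))]
    refine prod_congr rfl (fun i _ => ?_)
    exact (expect_comp_of_surjective (blockHom e) (blockHom_surjective e) (fun a => ψ (u a))).symm

end Alpha

/-! ### Chernoff bound for the weight of a uniform word -/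

section Chernoff

variable {ι : Type*} [Fintype ι]

theorem card_sub_two_mul_hammingNorm (w : ι → ZMod 2) :
    (Fintype.card ι : ℝ) - 2 * hammingNorm w = ∑ p, if w p = 0 then (1 : ℝ) else -1 := by
  have h : ∀ p, (if w p = 0 then (1 : ℝ) else -1) = 1 - 2 * (if w p ≠ 0 then 1 else 0) := by
    intro p
    split_ifs <;> simp_all
    norm_num
  simp only [h, sum_sub_distrib, ← mul_sum, sum_boole, hammingNorm]
  simp

theorem expect_exp_card_sub_two_mul_hammingNorm [DecidableEq ι] (l : ℝ) :
    𝔼 w : ι → ZMod 2, Real.exp (l * (Fintype.card ι - 2 * hammingNorm w)) =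
      Real.cosh l ^ Fintype.card ι := by
  classical
  simp only [card_sub_two_mul_hammingNorm, mul_sum, Real.exp_sum]
  rw [expect_pi_prod (fun _ z => Real.exp (l * if z = 0 then 1 else -1)), prod_const, card_univ]
  congr 1
  rw [Fintype.expect_eq_sum_div_card, Real.cosh_eq]
  have : (univ : Finset (ZMod 2)) = {0, 1} := rfl
  rw [this, sum_pair (by decide), ZMod.card]
  simp

/-- Exponential Markov inequality for both tails, with parameter `ε`; this choice minimises `-l ε N
+ l² N / 2`. -/
theorem uniformProb_lt_abs_card_sub_le [DecidableEq ι] {ε : ℝ} (hε : 0 ≤ ε) :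
    uniformProb (fun w : ι → ZMod 2 =>
      ε * Fintype.card ι < |(Fintype.card ι : ℝ) - 2 * hammingNorm w|) ≤
      2 * Real.exp (-(ε ^ 2 * Fintype.card ι / 2)) := by
  classical
  set N : ℝ := (Fintype.card ι : ℝ)
  rw [uniformProb_eq_expect]
  calc _ ≤ 𝔼 w : ι → ZMod 2, Real.exp (-(ε * (ε * N))) *
        (Real.exp (ε * (N - 2 * hammingNorm w)) + Real.exp (-ε * (N - 2 * hammingNorm w))) := by
        refine expect_le_expect (fun w _ => ?_)
        split_ifs with h
        · rw [mul_add, ← Real.exp_add, ← Real.exp_add]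
          rcases lt_abs.mp h with h | h
          · have : 1 ≤ Real.exp (-(ε * (ε * N)) + ε * (N - 2 * hammingNorm w)) :=
              Real.one_le_exp (by nlinarith)
            linarith [Real.exp_pos (-(ε * (ε * N)) + -ε * (N - 2 * hammingNorm w))]
          · have : 1 ≤ Real.exp (-(ε * (ε * N)) + -ε * (N - 2 * hammingNorm w)) :=
              Real.one_le_exp (by nlinarith)
            linarith [Real.exp_pos (-(ε * (ε * N)) + ε * (N - 2 * hammingNorm w))]
        · positivity
    _ = Real.exp (-(ε * (ε * N))) * (2 * Real.cosh ε ^ Fintype.card ι) := by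
        rw [← mul_expect, expect_add_distrib, expect_exp_card_sub_two_mul_hammingNorm,
          expect_exp_card_sub_two_mul_hammingNorm, Real.cosh_neg]
        ring
    _ ≤ Real.exp (-(ε * (ε * N))) * (2 * Real.exp (ε ^ 2 / 2) ^ Fintype.card ι) := by
        gcongr
        exact Real.cosh_le_exp_half_sq ε
    _ = _ := by
        rw [← Real.exp_nat_mul, mul_left_comm, ← Real.exp_add]
        congr 2
        ring

end Chernoff

/-! ### Weights of codewords and the union bound -/

section Code

variable {n t : ℕ} {K : Type*} [Field K]

/-- Words of `t + 1` blocks of `n` bits correspond to tuples of `t + 1` field elements. -/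
def wordEquiv (e : K ≃+ (Fin n → ZMod 2)) (t : ℕ) :
    K × (Fin t → K) ≃ (Fin (t + 1) × Fin n → ZMod 2) :=
  (Fin.consEquiv (fun _ => K)).trans
    ((Equiv.arrowCongr (Equiv.refl _) e.toEquiv).trans (Equiv.curry _ _ _).symm)

theorem codeword_eq_wordEquiv (e : K ≃+ (Fin n → ZMod 2)) (α : Fin t → K) (x : K) :
    codeword e α x = wordEquiv e t (x, fun i => α i * x) := rfl

theorem hammingNorm_eq_sum {ι : Type*} [Fintype ι] (w : ι → ZMod 2) :
    hammingNorm w = ∑ p, if w p ≠ 0 then 1 else 0 := by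
  rw [hammingNorm, card_filter]

theorem hammingNorm_wordEquiv (e : K ≃+ (Fin n → ZMod 2)) (x : K) (β : Fin t → K) :
    hammingNorm (wordEquiv e t (x, β)) = hammingNorm (e x) + ∑ i, hammingNorm (e (β i)) := by
  simp only [hammingNorm_eq_sum]
  rw [Fintype.sum_prod_type, Fin.sum_univ_succ]
  rfl

theorem codeword_sum (e : K ≃+ (Fin n → ZMod 2)) (α : Fin t → K) {ι : Type*} (s : Finset ι)
    (x : ι → K) (p : Fin (t + 1) × Fin n) :
    codeword e α (∑ j ∈ s, x j) p = ∑ j ∈ s, codeword e α (x j) p := by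
  obtain ⟨i, r⟩ := p
  refine Fin.cases ?_ (fun i => ?_) i <;> simp [codeword, mul_sum]

/-- The code has large distance and its coordinate family is `ε`-biased as soon as every nonzero
field element has a codeword of nearly balanced weight. -/
theorem code_of_balanced (hn : 1 ≤ n) (e : K ≃+ (Fin n → ZMod 2)) (α : Fin t → K) {ε : ℝ}
    (h : ∀ x ≠ 0, |(Fintype.card (Fin (t + 1) × Fin n) : ℝ) - 2 * hammingNorm (codeword e α x)| ≤
      ε * Fintype.card (Fin (t + 1) × Fin n)) :
    (∀ w ∈ code e α, w ≠ 0 → (1 - ε) * ((n : ℝ) + t * n) / 2 ≤ (hammingNorm w : ℝ)) ∧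
      IsEpsBiased (codePoint e α) ε := by
  classical
  have hN : (Fintype.card (Fin (t + 1) × Fin n) : ℝ) = n + t * n := by
    simp only [Fintype.card_prod, Fintype.card_fin]
    push_cast
    ring
  have hpos : (0 : ℝ) < n + t * n := by
    have : (1 : ℝ) ≤ n := by exact_mod_cast hn
    positivity
  rw [hN] at h
  refine ⟨?_, ?_⟩
  · rintro w ⟨x, rfl⟩ hw
    have hx : x ≠ 0 := by
      rintro rfl
      apply hw
      exact funext fun p => by simpa using codeword_sum e α (∅ : Finset ℕ) (fun _ => 0) p
    linarith [(abs_le.mp (h x hx)).2]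
  · intro T hT
    -- By additivity, the parity over `T` of point `p` is coordinate `p` of the codeword of this
    -- `x`.
    set x : K := ∑ j ∈ T, e.symm (Pi.single j 1) with hxdef
    have hx : x ≠ 0 := by
      obtain ⟨j, hj⟩ := hT
      intro h0
      have h1 : e x j = 1 := by
        rw [hxdef, map_sum]
        simp [Finset.sum_apply, Pi.single_apply, hj]
      rw [h0, map_zero] at h1
      exact zero_ne_one h1
    have hsum : ∀ p, ∑ j ∈ T, codePoint e α p j = codeword e α x p := fun p =>
      (codeword_sum e α T _ p).symm
    simp only [hsum]
    have key : uniformProb (fun p => codeword e α x p = 0) -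
        uniformProb (fun p => codeword e α x p = 1) =
        (((n : ℝ) + t * n) - 2 * hammingNorm (codeword e α x)) / (n + t * n) := by
      rw [uniformProb_eq_expect, uniformProb_eq_expect, ← expect_sub_distrib, ← hN,
        card_sub_two_mul_hammingNorm, Fintype.expect_eq_sum_div_card]
      congr 1
      refine sum_congr rfl (fun p _ => ?_)
      generalize codeword e α x p = z
      have h01 : ∀ z : ZMod 2, z = 0 ∨ z = 1 := by decide
      rcases h01 z with rfl | rfl <;> simp
    rw [key, abs_div, abs_of_pos hpos, div_le_iff₀ hpos]
    exact h x hx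

/-- The weight is at most `N`, so its residue modulo `N + 1` determines it, and `ZMod (N + 1)` can
serve as the finite group. For uniform `α`, multiplication by `x ≠ 0` permutes `K`, so the products
`α i * x` are again uniform. -/
theorem uniformProb_unbalanced_le [Fintype K] (e : K ≃+ (Fin n → ZMod 2)) (ε : ℝ) {x : K}
    (hx : x ≠ 0) :
    uniformProb (fun γ : NisanSeed (40 * n) (Nat.clog 2 t) =>
      ε * Fintype.card (Fin (t + 1) × Fin n) < |(Fintype.card (Fin (t + 1) × Fin n) : ℝ) -
        2 * hammingNorm (codeword e (nisanAlpha e t γ) x)|) ≤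
    uniformProb (fun β : Fin t → K =>
      ε * Fintype.card (Fin (t + 1) × Fin n) < |(Fintype.card (Fin (t + 1) × Fin n) : ℝ) -
        2 * hammingNorm (wordEquiv e t (x, β))|) +
      ((t + 1) * n + 1) * (2 ^ Nat.clog 2 t * (2 / √(2 ^ (40 * n)))) := by
  set N := Fintype.card (Fin (t + 1) × Fin n) with hNdef
  have hN : N = (t + 1) * n := by simp [hNdef]
  let u : K → ZMod (N + 1) := fun a => (hammingNorm (e (a * x)) : ℕ)
  let P : ZMod (N + 1) → Prop := fun s =>
    ε * N < |(N : ℝ) - 2 * (((hammingNorm (e x) : ℕ) : ZMod (N + 1)) + s).val|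
  have hval : ∀ α : Fin t → K,
      (((hammingNorm (e x) : ℕ) : ZMod (N + 1)) + ∑ i, u (α i)).val =
        hammingNorm (codeword e α x) := by
    intro α
    rw [codeword_eq_wordEquiv, hammingNorm_wordEquiv]
    simp only [u]
    rw [← Nat.cast_sum, ← Nat.cast_add, ZMod.val_natCast_of_lt]
    rw [← hammingNorm_wordEquiv]
    exact Nat.lt_succ_of_le hammingNorm_le_card_fintype
  have h := abs_uniformProb_nisanAlpha_sub_le (t := t) e u P
  simp only [P, hval, ZMod.card] at h
  have hmul : uniformProb (fun α : Fin t → K =>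
      ε * N < |(N : ℝ) - 2 * hammingNorm (codeword e α x)|) =
      uniformProb (fun β : Fin t → K =>
        ε * N < |(N : ℝ) - 2 * hammingNorm (wordEquiv e t (x, β))|) :=
    uniformProb_equiv (Equiv.arrowCongr (Equiv.refl (Fin t)) (Equiv.mulRight₀ x hx))
      (fun β : Fin t → K => ε * N < |(N : ℝ) - 2 * hammingNorm (wordEquiv e t (x, β))|)
  rw [hmul] at h
  have hcast : ((N + 1 : ℕ) : ℝ) = (t + 1) * n + 1 := by
    rw [hN]
    push_cast
    ring
  rw [hcast] at h
  linarith [(abs_le.mp h).2]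

/-- The systematic block `x` is not random for fixed `x`, but summing over `x` amounts to drawing it
uniformly, so no loss occurs in that block. -/
theorem sum_uniformProb_wordEquiv [Fintype K] (e : K ≃+ (Fin n → ZMod 2))
    (Q : (Fin (t + 1) × Fin n → ZMod 2) → Prop) :
    ∑ x, uniformProb (fun β : Fin t → K => Q (wordEquiv e t (x, β))) =
      2 ^ n * uniformProb Q := by
  classical
  have hK : (2 : ℝ) ^ n = Fintype.card K := by
    rw [Fintype.card_congr e.toEquiv]
    simp [ZMod.card]
  rw [hK, ← uniformProb_equiv (wordEquiv e t) Q]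
  simp only [uniformProb_eq_expect]
  rw [← univ_product_univ, expect_product, ← Fintype.card_mul_expect]

theorem uniformProb_compl {Ω : Type*} [Fintype Ω] [Nonempty Ω] (P : Ω → Prop) :
    uniformProb P = 1 - uniformProb (fun ω => ¬ P ω) := by
  classical
  rw [uniformProb_eq_expect, uniformProb_eq_expect, eq_sub_iff_add_eq, ← expect_add_distrib]
  rw [expect_congr rfl (g := fun _ => (1 : ℝ)) (fun ω _ => by by_cases h : P ω <;> simp [h]),
    Fintype.expect_const]

theorem uniformProb_exists_le {Ω ι : Type*} [Fintype Ω] (s : Finset ι) (P : ι → Ω → Prop) :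
    uniformProb (fun ω => ∃ i ∈ s, P i ω) ≤ ∑ i ∈ s, uniformProb (P i) := by
  classical
  simp only [uniformProb_eq_expect]
  rw [← expect_sum_comm]
  refine expect_le_expect (fun ω _ => ?_)
  have h0 : ∀ i ∈ s, (0 : ℝ) ≤ if P i ω then 1 else 0 := fun i _ => by positivity
  split_ifs with h
  · obtain ⟨i, hi, hP⟩ := h
    refine le_trans ?_ (single_le_sum h0 hi)
    simp [hP]
  · exact sum_nonneg h0

theorem one_sub_le_uniformProb_code (hn : 1 ≤ n) {ε : ℝ} (hε : 0 ≤ ε)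
    (e : K ≃+ (Fin n → ZMod 2)) :
    1 - (2 ^ n * (2 * Real.exp (-(ε ^ 2 * ((t + 1) * n) / 2))) +
      2 ^ n * (((t + 1) * n + 1) * (2 ^ Nat.clog 2 t * (2 / √(2 ^ (40 * n)))))) ≤
    uniformProb (fun γ : NisanSeed (40 * n) (Nat.clog 2 t) =>
      (∀ w ∈ code e (nisanAlpha e t γ), w ≠ 0 →
        (1 - ε) * ((n : ℝ) + t * n) / 2 ≤ (hammingNorm w : ℝ)) ∧
      IsEpsBiased (codePoint e (nisanAlpha e t γ)) ε) := by
  classical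
  have : Fintype K := Fintype.ofEquiv _ e.symm.toEquiv
  set η : ℝ := ((t + 1) * n + 1) * (2 ^ Nat.clog 2 t * (2 / √(2 ^ (40 * n))))
  have hη : 0 ≤ η := by positivity
  set N := Fintype.card (Fin (t + 1) × Fin n) with hNdef
  have hN : (N : ℝ) = (t + 1) * n := by simp [hNdef]
  let Q : (Fin (t + 1) × Fin n → ZMod 2) → Prop := fun w =>
    ε * N < |(N : ℝ) - 2 * hammingNorm w|
  have hK : (Fintype.card K : ℝ) = 2 ^ n := by
    rw [Fintype.card_congr e.toEquiv]
    simp [ZMod.card]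
  have hbad : uniformProb (fun γ : NisanSeed (40 * n) (Nat.clog 2 t) =>
      ∃ x ∈ univ.erase (0 : K), Q (codeword e (nisanAlpha e t γ) x)) ≤
      2 ^ n * (2 * Real.exp (-(ε ^ 2 * ((t + 1) * n) / 2))) + 2 ^ n * η := by
    calc _ ≤ ∑ x ∈ univ.erase (0 : K),
          uniformProb (fun γ : NisanSeed (40 * n) (Nat.clog 2 t) =>
            Q (codeword e (nisanAlpha e t γ) x)) := uniformProb_exists_le _ _
      _ ≤ ∑ x ∈ univ.erase (0 : K),
          (uniformProb (fun β : Fin t → K => Q (wordEquiv e t (x, β))) + η) :=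
          sum_le_sum (fun x hx => uniformProb_unbalanced_le e ε (ne_of_mem_erase hx))
      -- The term `x = 0` is added back so that `x` ranges over all of `K`.
      _ ≤ ∑ x, (uniformProb (fun β : Fin t → K => Q (wordEquiv e t (x, β))) + η) :=
          sum_le_sum_of_subset_of_nonneg (erase_subset _ _)
            (fun x _ _ => add_nonneg (div_nonneg (Nat.cast_nonneg _) (Nat.cast_nonneg _)) hη)
      _ = 2 ^ n * uniformProb Q + 2 ^ n * η := by
          rw [sum_add_distrib, sum_uniformProb_wordEquiv e Q, sum_const, card_univ,
            nsmul_eq_mul, hK]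
      _ ≤ _ := by
          have h := uniformProb_lt_abs_card_sub_le (ι := Fin (t + 1) × Fin n) hε
          rw [← hNdef, hN] at h
          simp only [Q, hN]
          gcongr
  refine le_trans ?_ (uniformProb_mono (P := fun γ : NisanSeed (40 * n) (Nat.clog 2 t) =>
    ¬ ∃ x ∈ univ.erase (0 : K), Q (codeword e (nisanAlpha e t γ) x)) (fun γ hγ => ?_))
  · rw [uniformProb_compl]
    simp only [not_not]
    linarith
  · refine code_of_balanced hn e _ (fun x hx => ?_)
    by_contra hlt
    exact hγ ⟨x, by simpa using hx, not_le.mp hlt⟩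

end Code

/-! ### Parameters and the main theorem -/

theorem pow_clog_le_two_mul {t : ℕ} (ht : 1 ≤ t) : 2 ^ Nat.clog 2 t ≤ 2 * t := by
  rcases ht.eq_or_lt with rfl | ht
  · simp
  · have h := Nat.pow_pred_clog_lt_self one_lt_two ht
    have hpos : 0 < Nat.clog 2 t := Nat.clog_pos one_lt_two ht
    obtain ⟨k, hk⟩ := Nat.exists_eq_succ_of_ne_zero hpos.ne'
    rw [hk] at h ⊢
    rw [Nat.pred_succ] at h
    rw [pow_succ]
    omega

/-- With `q = 2 ^ n`, one has `n ≤ q` and `t ≤ q ^ 2`, so the prefactors are at most of order `q ^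
6`, while blocks of `40 n` bits supply `q ^ (-20)`. -/
theorem generator_error_le {n t : ℕ} (ht1 : 1 ≤ t) (ht : t ≤ 2 ^ (2 * n)) :
    (2 : ℝ) ^ n * (((t + 1) * n + 1) * (2 ^ Nat.clog 2 t * (2 / √(2 ^ (40 * n))))) ≤
      12 * ((2 : ℝ) ^ n)⁻¹ := by
  set q : ℝ := 2 ^ n
  have hq : 1 ≤ q := one_le_pow₀ one_le_two
  have hsqrt : √((2 : ℝ) ^ (40 * n)) = q ^ 20 := by
    rw [show (2 : ℝ) ^ (40 * n) = (q ^ 20) ^ 2 by simp only [q]; rw [← pow_mul, ← pow_mul]; ring_nf]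
    exact Real.sqrt_sq (by positivity)
  have htq : (t : ℝ) ≤ q ^ 2 := by
    have : (t : ℝ) ≤ 2 ^ (2 * n) := by exact_mod_cast ht
    rwa [mul_comm 2 n, pow_mul] at this
  have hnq : (n : ℝ) ≤ q := by
    have : n ≤ 2 ^ n := Nat.lt_two_pow_self.le
    simp only [q]
    exact_mod_cast this
  have hclog : (2 : ℝ) ^ Nat.clog 2 t ≤ 2 * q ^ 2 := by
    have : (2 : ℝ) ^ Nat.clog 2 t ≤ 2 * t := by exact_mod_cast pow_clog_le_two_mul ht1
    linarith
  have hN : ((t : ℝ) + 1) * n + 1 ≤ 3 * q ^ 3 := by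
    have h1 : ((t : ℝ) + 1) * n ≤ (q ^ 2 + 1) * q := by gcongr
    nlinarith [one_le_pow₀ hq (n := 2), one_le_pow₀ hq (n := 3)]
  rw [hsqrt]
  calc q * (((t + 1) * n + 1) * (2 ^ Nat.clog 2 t * (2 / q ^ 20)))
      ≤ q * (3 * q ^ 3 * (2 * q ^ 2 * (2 / q ^ 20))) := by gcongr
    _ = 12 * (q ^ 14)⁻¹ := by
        field_simp
        norm_num
    _ ≤ 12 * q⁻¹ := by
        gcongr
        exact le_self_pow₀ hq (by norm_num)

theorem mainTheorem1 (A : ℝ) (hA : 2 * Real.log 2 < A) :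
    ∃ c : ℝ, 0 < c ∧ ∃ C : ℝ, 0 < C ∧
      ∀ ε₀ : ℝ, ε₀ < 1 → ∃ D : ℝ, 0 < D ∧
        ∀ (n : ℕ) (ε : ℝ) (t : ℕ), 1 ≤ n → 0 < ε → ε ≤ ε₀ →
          t = ⌈A / ε ^ 2⌉₊ → t ≤ 2 ^ (2 * n) →
          ∀ (K : Type*) [Field K] (e : K ≃+ (Fin n → ZMod 2)),
            -- with high probability over the seed
            1 - C * (2 : ℝ) ^ (-(c * n)) ≤
              uniformProb (fun γ : NisanSeed (40 * n) (Nat.clog 2 t) =>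
                (∀ w ∈ code e (nisanAlpha e t γ), w ≠ 0 →
                  (1 - ε) * ((n : ℝ) + t * n) / 2 ≤ (hammingNorm w : ℝ)) ∧
                IsEpsBiased (codePoint e (nisanAlpha e t γ)) ε) ∧
            -- the number of points
            (Fintype.card (Fin (t + 1) × Fin n) : ℝ) ≤ C * (n / ε ^ 2) ∧
            -- the number of random bits
            (Fintype.card (NisanSeedPos (40 * n) (Nat.clog 2 t)) : ℝ) ≤
              D * (n * Real.logb 2 (1 / ε)) := by
  have hlog2 : 0 < Real.log 2 := Real.log_pos one_lt_two
  have hA0 : 0 < A := by linarith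
  -- The second entry is the rate of `2 ^ n * exp (-A n / 2)` in base 2; the first covers the
  -- generator error `2 ^ (-n)`.
  set c : ℝ := min 1 ((A / 2 - Real.log 2) / Real.log 2) with hc
  have hc0 : 0 < c := lt_min one_pos (div_pos (by linarith) hlog2)
  -- `14 = 2 + 12` adds the Chernoff and generator constants; `14 + A` also exceeds the `A + 2`
  -- needed for the number of points.
  refine ⟨c, hc0, 14 + A, by linarith, fun ε₀ hε₀ => ?_⟩
  set a : ℝ := Real.logb 2 (A + 1) + 1 with ha
  have ha0 : 0 < a := by
    have := Real.logb_nonneg one_lt_two (show (1 : ℝ) ≤ A + 1 by linarith)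
    linarith
  -- A positive lower bound for `log₂ (1 / ε)`. If `ε₀ ≤ 0` no `ε` is admissible, and `1` only keeps
  -- `D` positive.
  set L₀ : ℝ := if 0 < ε₀ then Real.logb 2 (1 / ε₀) else 1 with hL₀
  have hL₀pos : 0 < L₀ := by
    rw [hL₀]
    split_ifs with h
    · exact Real.logb_pos one_lt_two (by rw [lt_div_iff₀ h]; linarith)
    · exact one_pos
  -- The seed has at most `40 n + 120 n k` bits with `k ≤ a + 2 L`; the part without `L` is absorbed
  -- using `L / L₀ ≥ 1`.
  refine ⟨(40 + 120 * a) / L₀ + 240, by positivity, ?_⟩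
  intro n ε t hn hε hεε₀ ht ht2 K _ e
  have hε1 : ε < 1 := by linarith
  have hn0 : (1 : ℝ) ≤ n := by exact_mod_cast hn
  have hε2 : 0 < ε ^ 2 := by positivity
  have hε2' : ε ^ 2 ≤ 1 := by nlinarith
  have hAt : A / ε ^ 2 ≤ t := by rw [ht]; exact Nat.le_ceil _
  have hAt' : (t : ℝ) ≤ A / ε ^ 2 + 1 := by
    rw [ht]; exact (Nat.ceil_lt_add_one (by positivity)).le
  have hinv : 1 ≤ 1 / ε ^ 2 := by rw [le_div_iff₀ hε2]; linarith
  have ht1 : 1 ≤ t := by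
    have : (0 : ℝ) < t := lt_of_lt_of_le (by positivity) hAt
    exact_mod_cast this
  refine ⟨?_, ?_, ?_⟩
  · refine le_trans ?_ (one_sub_le_uniformProb_code hn hε.le e)
    have hgen := generator_error_le ht1 ht2
    have h1 : ((2 : ℝ) ^ n)⁻¹ ≤ 2 ^ (-(c * n)) := by
      rw [← Real.rpow_natCast, ← Real.rpow_neg zero_le_two]
      refine Real.rpow_le_rpow_of_exponent_le one_le_two ?_
      have : c * n ≤ 1 * n := by gcongr; exact min_le_left _ _
      linarith
    have h2 : (2 : ℝ) ^ n * (2 * Real.exp (-(ε ^ 2 * ((t + 1) * n) / 2))) ≤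
        2 * 2 ^ (-(c * n)) := by
      rw [Real.rpow_def_of_pos two_pos, ← Real.rpow_natCast, Real.rpow_def_of_pos two_pos,
        mul_left_comm, ← Real.exp_add]
      gcongr
      have hcl : c * Real.log 2 ≤ A / 2 - Real.log 2 :=
        (le_div_iff₀ hlog2).mp (min_le_right _ _)
      have hAt2 : A ≤ t * ε ^ 2 := (div_le_iff₀ hε2).mp hAt
      have h3 : A * n ≤ ε ^ 2 * ((t + 1) * n) := by nlinarith
      nlinarith
    have h4 : (0 : ℝ) < 2 ^ (-(c * n)) := by positivity
    nlinarith
  · simp only [Fintype.card_prod, Fintype.card_fin]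
    push_cast
    calc ((t : ℝ) + 1) * n ≤ ((14 + A) * (1 / ε ^ 2)) * n := by
          gcongr
          have : A / ε ^ 2 = A * (1 / ε ^ 2) := by ring
          nlinarith
      _ = _ := by ring
  · set L := Real.logb 2 (1 / ε) with hL
    have hLL₀ : L₀ ≤ L := by
      have hε₀pos : 0 < ε₀ := hε.trans_le hεε₀
      rw [hL₀, if_pos hε₀pos]
      exact Real.logb_le_logb_of_le one_lt_two (by positivity)
        (one_div_le_one_div_of_le hε hεε₀)
    set k := Nat.clog 2 t with hk
    have hkL : (k : ℝ) ≤ a + 2 * L := by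
      have h1 : (2 : ℝ) ^ k ≤ 2 * ((A + 1) * (1 / ε) ^ 2) := by
        have : (2 : ℝ) ^ k ≤ 2 * t := by exact_mod_cast pow_clog_le_two_mul ht1
        have h2 : A / ε ^ 2 + 1 ≤ (A + 1) * (1 / ε) ^ 2 := by
          rw [one_div_pow]
          have : A / ε ^ 2 = A * (1 / ε ^ 2) := by ring
          nlinarith
        linarith
      have h2 := Real.logb_le_logb_of_le one_lt_two (by positivity) h1
      rw [Real.logb_pow, Real.logb_self_eq_one one_lt_two, Real.logb_mul two_ne_zero
        (by positivity), Real.logb_mul (by positivity) (by positivity), Real.logb_pow,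
        Real.logb_self_eq_one one_lt_two] at h2
      push_cast at h2
      linarith
    have hcard : (Fintype.card (NisanSeedPos (40 * n) k) : ℝ) ≤ 40 * n + k * (120 * n) := by
      have : Fintype.card (NisanSeedPos (40 * n) k) ≤ 40 * n + k * (120 * n) := by
        simp only [Fintype.card_sum, Fintype.card_prod, Fintype.card_fin]
        gcongr
        omega
      exact_mod_cast this
    calc _ ≤ 40 * (n : ℝ) + k * (120 * n) := hcard
      _ ≤ 40 * (n : ℝ) + (a + 2 * L) * (120 * n) := by gcongr
      _ = ((40 + 120 * a) + 240 * L) * n := by ring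
      _ ≤ ((40 + 120 * a) / L₀ * L + 240 * L) * n := by
          gcongr
          rw [div_mul_eq_mul_div, le_div_iff₀ hL₀pos]
          gcongr
      _ = _ := by ring
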